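/- Let $R_1=\mathbb F_2[z,\frac1{z(1+z)}]$ and let $\mathfrak O_1=R_1\oplus R_1 I\oplus R_1 J\oplus R_1 IJ$ be the $R_1$-algebra with multiplication determined by $I^2+I=z$, $J^2=1+z^3$, $IJ=J(I+1)$ (an order in the quaternion algebra $\bigl[\frac{z,\,1+z^3}{\mathbb F_2(z)}\bigr)$). The elements \[ C_1=1+z^2+IJ,\quad C_2=z+z^2+IJ,\quad B_1=(1+z)I+J,\quad B_2=z+z^2+(1+z)I+J+IJ \] are invertible in $\mathfrak O_1$; let $c_1,c_2,b_1,b_2$ be their images in the group $G(R_1)=\mathfrak O_1^\times/R_1^\times$. Let $\Gamma=\langle a_1,a_2\rangle\le G(R_1)$ be the subgroup generated by $a_1=c_1b_1^{-1}$ and $a_2=c_2b_2^{-1}$. Then the abelianization $\Gamma^{\mathrm{ab}}$ is isomorphic to $\mathbb Z/15\mathbb Z$. -/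

import Mathlib

namespace QuatLattice

/-- The ring `R₁ = 𝔽₂[z, 1 / (z (1 + z))]`. -/
noncomputable abbrev R1 : Type :=
  Localization.Away
    ((Polynomial.X : Polynomial (ZMod 2)) * (1 + (Polynomial.X : Polynomial (ZMod 2))))

/-- The element `z` of `R₁`. -/
noncomputable def z : R1 :=
  algebraMap (Polynomial (ZMod 2)) R1 Polynomial.X

/-- The `R₁`-order `𝔒₁ = R₁ ⊕ R₁ I ⊕ R₁ J ⊕ R₁ I J`, where `I ^ 2 = z + I`, `J ^ 2 = 1 + z ^ 3`
and `J I = J - I J` (that is, `I J = J (I + 1)`, since `2 = 0`).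
The components `re`, `imI`, `imJ`, `imK` are the coordinates with respect to `1`, `I`, `J`, `I J`;
see `I_relation`, `J_relation`, `IJ_relation` and `basis_expansion` below. -/
noncomputable abbrev O1 : Type := QuaternionAlgebra R1 z 1 (1 + z ^ 3)

/-- The quaternion `I`. -/
noncomputable def I : O1 := ⟨0, 1, 0, 0⟩

/-- The quaternion `J`. -/
noncomputable def J : O1 := ⟨0, 0, 1, 0⟩

theorem two_eq_zero : (2 : R1) = 0 := by
  have h : (2 : Polynomial (ZMod 2)) = 0 := CharTwo.two_eq_zero
  have h2 := congrArg (algebraMap (Polynomial (ZMod 2)) R1) h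
  rwa [map_ofNat, map_zero] at h2

theorem add_self_zero (x : R1) : x + x = 0 := by
  linear_combination x * two_eq_zero

theorem I_relation : I ^ 2 + I = algebraMap R1 O1 z := by
  rw [pow_two]
  ext <;> simp [I, QuaternionAlgebra.algebraMap_eq, add_self_zero]

theorem J_relation : J ^ 2 = algebraMap R1 O1 (1 + z ^ 3) := by
  rw [pow_two]
  ext <;> simp [J, QuaternionAlgebra.algebraMap_eq]

theorem IJ_relation : I * J = J * (I + 1) := by
  ext <;> simp [I, J]
  · linear_combination -two_eq_zero
  · linear_combination two_eq_zero

theorem basis_expansion (q : O1) :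
    q = q.re • (1 : O1) + q.imI • I + q.imJ • J + q.imK • (I * J) := by
  ext <;> simp [I, J]

/-- The quaternion `C₁ = 1 + z² + I J`. -/
noncomputable def C1 : O1 := algebraMap R1 O1 (1 + z ^ 2) + I * J

/-- The quaternion `C₂ = z + z² + I J`. -/
noncomputable def C2 : O1 := algebraMap R1 O1 (z + z ^ 2) + I * J

/-- The quaternion `B₁ = (1 + z) I + J`. -/
noncomputable def B1 : O1 := (1 + z) • I + J

/-- The quaternion `B₂ = z + z² + (1 + z) I + J + I J`. -/
noncomputable def B2 : O1 := algebraMap R1 O1 (z + z ^ 2) + (1 + z) • I + J + I * J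

theorem isUnit_z_mul : IsUnit (z * (1 + z)) := by
  have h := IsLocalization.Away.algebraMap_isUnit (S := R1)
    ((Polynomial.X : Polynomial (ZMod 2)) * (1 + (Polynomial.X : Polynomial (ZMod 2))))
  rwa [map_mul, map_add, map_one] at h

theorem isUnit_one_add_z : IsUnit (1 + z) := isUnit_of_mul_isUnit_right isUnit_z_mul

/-- A quaternion whose reduced norm `q * star q` is a unit of `R₁` is invertible. -/
theorem isUnit_of_norm (q : O1) (n : R1) (hn : IsUnit n)
    (h1 : q * star q = algebraMap R1 O1 n) (h2 : star q * q = algebraMap R1 O1 n) :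
    IsUnit q := by
  have hu : IsUnit (algebraMap R1 O1 n) := hn.map _
  have hl : IsUnit (q * star q) := h1 ▸ hu
  have hc : Commute q (star q) := h1.trans h2.symm
  exact (hc.isUnit_mul_iff.mp hl).1

theorem isUnit_C1 : IsUnit C1 := by
  refine isUnit_of_norm C1 (1 + z) isUnit_one_add_z ?_ ?_ <;> ext <;>
    simp [C1, I, J, QuaternionAlgebra.algebraMap_eq] <;>
    linear_combination (z ^ 4 + z ^ 2) * two_eq_zero

theorem isUnit_C2 : IsUnit C2 := by
  refine isUnit_of_norm C2 (z * (1 + z)) isUnit_z_mul ?_ ?_ <;> ext <;>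
    simp [C2, I, J, QuaternionAlgebra.algebraMap_eq] <;>
    linear_combination (z ^ 4 + z ^ 3) * two_eq_zero

theorem isUnit_B1 : IsUnit B1 := by
  refine isUnit_of_norm B1 (1 + z) isUnit_one_add_z ?_ ?_ <;> ext <;>
    simp [B1, I, J, QuaternionAlgebra.algebraMap_eq] <;>
    first
    | linear_combination -(z ^ 3 + z ^ 2 + z + 1) * two_eq_zero
    | grind [two_eq_zero]

theorem isUnit_B2 : IsUnit B2 := by
  refine isUnit_of_norm B2 (z * (1 + z)) isUnit_z_mul ?_ ?_ <;> ext <;>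
    simp [B2, I, J, QuaternionAlgebra.algebraMap_eq] <;>
    first
    | linear_combination (z ^ 4 - 1) * two_eq_zero
    | grind [two_eq_zero]

/-- The subgroup `R₁ˣ` of `𝔒₁ˣ`. -/
noncomputable def scalarUnits : Subgroup O1ˣ :=
  (Units.map (algebraMap R1 O1 : R1 →* O1)).range

instance scalarUnits_normal : scalarUnits.Normal := by
  constructor
  rintro _ ⟨r, rfl⟩ g
  refine ⟨r, ?_⟩
  apply Units.ext
  have h : (algebraMap R1 O1 (r : R1)) * (g : O1) = g * algebraMap R1 O1 (r : R1) :=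
    Algebra.commutes _ _
  change algebraMap R1 O1 (r : R1) = g * algebraMap R1 O1 (r : R1) * ((g⁻¹ : O1ˣ) : O1)
  rw [← h, mul_assoc, Units.mul_inv, mul_one]

/-- The group `G(R₁) = 𝔒₁ˣ / R₁ˣ`. -/
noncomputable abbrev GR1 : Type := O1ˣ ⧸ scalarUnits

/-- The image of `C₁` in `G(R₁)`. -/
noncomputable def c1 : GR1 := QuotientGroup.mk isUnit_C1.unit

/-- The image of `C₂` in `G(R₁)`. -/
noncomputable def c2 : GR1 := QuotientGroup.mk isUnit_C2.unit

/-- The image of `B₁` in `G(R₁)`. -/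
noncomputable def b1 : GR1 := QuotientGroup.mk isUnit_B1.unit

/-- The image of `B₂` in `G(R₁)`. -/
noncomputable def b2 : GR1 := QuotientGroup.mk isUnit_B2.unit

/-- The lattice `Γ = ⟨a₁, a₂⟩ ≤ G(R₁)` with `a₁ = c₁ b₁⁻¹` and `a₂ = c₂ b₂⁻¹`. -/
noncomputable def Gam : Subgroup GR1 := Subgroup.closure {c1 * b1⁻¹, c2 * b2⁻¹}

end QuatLattice

namespace QuatLattice

open Polynomial

/-! The generators `a₁`, `a₂` lift to units `A1`, `A2` of reduced norm 1 in the order `O0` over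
𝔽₂[z, 1/z], where `1 + z` is not inverted.

Upper bound: `relation_one` and `relation_two` hold exactly in `O0ˣ`. In the abelianization, written
additively, they become `a₁ + 7 a₂ = 0` and `a₂ = 2 a₁`, so the group is cyclic, generated by `a₁`,
with `15 a₁ = 0`.

Lower bound: the algebra degenerates at the places dividing `1 + z³ = (1 + z)(1 + z + z²)`. Killing
`J` there maps `O0` to 𝔽₄ (at `z = 1`) and to 𝔽₁₆ (at `z` a primitive cube root of unity). Modulo
scalars the targets are 𝔽₄ˣ/𝔽₂ˣ and 𝔽₁₆ˣ/𝔽₄ˣ, of orders 3 and 5, and `a₁` is nontrivial in both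
(`orderOf_dvd_of_reduction`). The place `z = 1` is the reason for leaving `R1`. -/

/-! ### The order over 𝔽₂[z, 1/z] and the lifted generators -/

theorem X_mul_one_add_X_ne_zero : (X : (ZMod 2)[X]) * (1 + X) ≠ 0 := by
  refine mul_ne_zero X_ne_zero fun h => ?_
  have := congrArg (eval 0) h
  simp at this

/-- The ring `𝔽₂[z, 1 / z]`. -/
def R0 : Type := Localization.Away (X : (ZMod 2)[X])

noncomputable instance commRing_R0 : CommRing R0 :=
  inferInstanceAs (CommRing (Localization.Away (X : (ZMod 2)[X])))

noncomputable instance algebra_R0 : Algebra (ZMod 2)[X] R0 :=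
  inferInstanceAs (Algebra (ZMod 2)[X] (Localization.Away (X : (ZMod 2)[X])))

instance isLocalization_R0 : IsLocalization.Away (X : (ZMod 2)[X]) R0 :=
  inferInstanceAs (IsLocalization.Away (X : (ZMod 2)[X]) (Localization.Away (X : (ZMod 2)[X])))

/-- The element `z` of `R0`. -/
noncomputable def z0 : R0 := algebraMap (ZMod 2)[X] R0 X

/-- The element `1 / z` of `R0`. -/
noncomputable def w0 : R0 := IsLocalization.Away.invSelf (X : (ZMod 2)[X])

theorem z0_mul_w0 : z0 * w0 = 1 := IsLocalization.Away.mul_invSelf _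

theorem algebraMap_R0_injective : Function.Injective (algebraMap (ZMod 2)[X] R0) :=
  IsLocalization.injective R0 (powers_le_nonZeroDivisors_of_noZeroDivisors X_ne_zero)

theorem algebraMap_R1_injective : Function.Injective (algebraMap (ZMod 2)[X] R1) :=
  IsLocalization.injective R1
    (powers_le_nonZeroDivisors_of_noZeroDivisors X_mul_one_add_X_ne_zero)

instance charP_R0 : CharP R0 2 := charP_of_injective_algebraMap algebraMap_R0_injective 2

instance charP_R1 : CharP R1 2 := charP_of_injective_algebraMap algebraMap_R1_injective 2

/-- The order `𝔒₀ = R0 ⊕ R0 I ⊕ R0 J ⊕ R0 I J`, with the same relations as `𝔒₁`. -/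
noncomputable abbrev O0 : Type := QuaternionAlgebra R0 z0 1 (1 + z0 ^ 3)

/-- The ring homomorphism out of `R0` that sends `z` to the unit `t`. -/
noncomputable def evalR0 {T : Type*} [CommRing T] [Algebra (ZMod 2) T] (t : T) (ht : IsUnit t) :
    R0 →+* T :=
  IsLocalization.Away.lift (X : (ZMod 2)[X]) (g := (aeval t : (ZMod 2)[X] →ₐ[ZMod 2] T).toRingHom)
    (by simpa using ht)

theorem evalR0_z0 {T : Type*} [CommRing T] [Algebra (ZMod 2) T] (t : T) (ht : IsUnit t) :
    evalR0 t ht z0 = t := by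
  simp [evalR0, z0]

theorem ringHom_R0_ext {T : Type*} [CommRing T] {f g : R0 →+* T} (h : f z0 = g z0) : f = g := by
  refine IsLocalization.ringHom_ext (Submonoid.powers (X : (ZMod 2)[X])) ?_
  refine Polynomial.ringHom_ext' (Subsingleton.elim _ _) h

/-- The inclusion `R0 → R1`. -/
noncomputable def inclR : R0 →+* R1 :=
  IsLocalization.Away.lift (X : (ZMod 2)[X]) (g := algebraMap (ZMod 2)[X] R1)
    (isUnit_of_mul_isUnit_left isUnit_z_mul)

theorem inclR_z0 : inclR z0 = z := by simp [inclR, z0, z]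

theorem inclR_w0 : z * inclR w0 = 1 := by
  rw [← inclR_z0, ← map_mul, z0_mul_w0, map_one]

theorem inclR_injective : Function.Injective inclR := by
  refine (IsLocalization.lift_injective_iff _).2 fun x y => ?_
  rw [algebraMap_R0_injective.eq_iff, algebraMap_R1_injective.eq_iff]

/-- The inclusion of quaternion orders induced by `R0 → R1`. -/
noncomputable def inclO : O0 →* O1 where
  toFun q := ⟨inclR q.re, inclR q.imI, inclR q.imJ, inclR q.imK⟩
  map_one' := by ext <;> simp
  map_mul' p q := by ext <;> simp [inclR_z0]

/-- The map `𝔒₀ˣ → G(R₁)`. -/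
noncomputable def toGR1 : O0ˣ →* GR1 :=
  (QuotientGroup.mk' scalarUnits).comp (Units.map inclO)

/-- The kernel of `toGR1` consists of scalars; the `I`-coordinate is all that the reductions below
need to detect this. -/
theorem imI_eq_zero_of_toGR1_eq_one {u : O0ˣ} (hu : toGR1 u = 1) : (u : O0).imI = 0 := by
  obtain ⟨r, hr⟩ : Units.map inclO u ∈ scalarUnits := (QuotientGroup.eq_one_iff _).1 hu
  have h : algebraMap R1 O1 r = inclO u := congrArg Units.val hr
  refine inclR_injective ?_
  simpa [inclO, QuaternionAlgebra.algebraMap_eq] using (congrArg QuaternionAlgebra.imI h).symm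

/-- The lift `1 + z² + z I + J + I J` of `a₁` to `𝔒₀ˣ`. -/
noncomputable def A1 : O0ˣ where
  val := ⟨1 + z0 ^ 2, z0, 1, 1⟩
  inv := ⟨1 + z0 ^ 2 + z0, z0, 1, 1⟩
  val_inv := by ext <;> simp <;> grind
  inv_val := by ext <;> simp <;> grind

/-- The lift `z + z⁻¹ I + z⁻¹ I J` of `a₂` to `𝔒₀ˣ`. -/
noncomputable def A2 : O0ˣ where
  val := ⟨z0, w0, 0, w0⟩
  inv := ⟨z0 + w0, w0, 0, w0⟩
  val_inv := by ext <;> simp <;> grind [z0_mul_w0]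
  inv_val := by ext <;> simp <;> grind [z0_mul_w0]

theorem toGR1_A1 : toGR1 A1 = c1 * b1⁻¹ := by
  rw [eq_mul_inv_iff_mul_eq]
  refine congrArg (QuotientGroup.mk (s := scalarUnits)) (Units.ext ?_)
  change inclO A1 * B1 = C1
  ext <;> simp [inclO, A1, B1, C1, I, J, inclR_z0, QuaternionAlgebra.algebraMap_eq] <;>
    grind

theorem toGR1_A2 : toGR1 A2 = c2 * b2⁻¹ := by
  rw [eq_mul_inv_iff_mul_eq]
  refine congrArg (QuotientGroup.mk (s := scalarUnits)) (Units.ext ?_)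
  change inclO A2 * B2 = C2
  ext <;> simp [inclO, A2, B2, C2, I, J, inclR_z0, QuaternionAlgebra.algebraMap_eq] <;>
    grind [inclR_w0]

theorem coe_A1 : (A1 : O0) = ⟨1 + z0 ^ 2, z0, 1, 1⟩ := rfl

theorem coe_A1_inv : ((A1⁻¹ : O0ˣ) : O0) = ⟨1 + z0 ^ 2 + z0, z0, 1, 1⟩ := rfl

theorem coe_A2 : (A2 : O0) = ⟨z0, w0, 0, w0⟩ := rfl

theorem coe_A2_inv : ((A2⁻¹ : O0ˣ) : O0) = ⟨z0 + w0, w0, 0, w0⟩ := rfl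

/-! ### Two relations between the lifts -/

theorem quaternion_relation_one {R : Type*} [CommRing R] [CharP R 2] {z w : R} (h : z * w = 1)
    {a a' b b' : QuaternionAlgebra R z 1 (1 + z ^ 3)}
    (ha : a = ⟨1 + z ^ 2, z, 1, 1⟩) (ha' : a' = ⟨1 + z ^ 2 + z, z, 1, 1⟩)
    (hb : b = ⟨z, w, 0, w⟩) (hb' : b' = ⟨z + w, w, 0, w⟩) :
    b * a * b * a' * b * b = a * b' * b' * a' * b' * a' := by
  -- Both words are expanded one letter at a time, each partial product being reduced by `z * w = 1`
  -- and characteristic 2.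
  have l2 : b * a =
      ⟨1, 1 + z, 1, w⟩ := by
    rw [hb, ha, QuaternionAlgebra.mk_mul_mk]
    ext <;> dsimp only <;> grind
  have l3 : b * a * b =
      ⟨1, w + 1 + z, 1, w⟩ := by
    rw [l2, hb, QuaternionAlgebra.mk_mul_mk]
    ext <;> dsimp only <;> grind
  have l4 : b * a * b * a' =
      ⟨0, z, 1, w⟩ := by
    rw [l3, ha', QuaternionAlgebra.mk_mul_mk]
    ext <;> dsimp only <;> grind
  have l5 : b * a * b * a' * b =
      ⟨z, w + 1, 0, w⟩ := by
    rw [l4, hb, QuaternionAlgebra.mk_mul_mk]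
    ext <;> dsimp only <;> grind
  have l6 : b * a * b * a' * b * b =
      ⟨1, w ^ 2 + w + z, 1, w ^ 2 + w⟩ := by
    rw [l5, hb, QuaternionAlgebra.mk_mul_mk]
    ext <;> dsimp only <;> grind
  have r2 : a * b' =
      ⟨1 + z + z ^ 2, z, 1, w + 1⟩ := by
    rw [ha, hb', QuaternionAlgebra.mk_mul_mk]
    ext <;> dsimp only <;> grind
  have r3 : a * b' * b' =
      ⟨w + z + z ^ 2, 1 + z, w + 1, w ^ 2 + w + 1⟩ := by
    rw [r2, hb', QuaternionAlgebra.mk_mul_mk]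
    ext <;> dsimp only <;> grind
  have r4 : a * b' * b' * a' =
      ⟨z, w ^ 2, 0, w ^ 2 + w⟩ := by
    rw [r3, ha', QuaternionAlgebra.mk_mul_mk]
    ext <;> dsimp only <;> grind
  have r5 : a * b' * b' * a' * b' =
      ⟨w + 1 + z, w + 1, w, w ^ 2 + w⟩ := by
    rw [r4, hb', QuaternionAlgebra.mk_mul_mk]
    ext <;> dsimp only <;> grind
  have r6 : a * b' * b' * a' * b' * a' =
      ⟨1, w ^ 2 + w + z, 1, w ^ 2 + w⟩ := by
    rw [r5, ha', QuaternionAlgebra.mk_mul_mk]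
    ext <;> dsimp only <;> grind
  rw [l6, r6]

theorem quaternion_relation_two {R : Type*} [CommRing R] [CharP R 2] {z w : R} (h : z * w = 1)
    {a a' b b' : QuaternionAlgebra R z 1 (1 + z ^ 3)}
    (ha : a = ⟨1 + z ^ 2, z, 1, 1⟩) (ha' : a' = ⟨1 + z ^ 2 + z, z, 1, 1⟩)
    (hb : b = ⟨z, w, 0, w⟩) (hb' : b' = ⟨z + w, w, 0, w⟩) :
    a * a * b' * a' * b' * b' * a = b' * b' * a * b' * a' * b := by
  have l2 : a * a =
      ⟨1 + z + z ^ 3, z ^ 2, z, z⟩ := by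
    rw [ha, QuaternionAlgebra.mk_mul_mk]
    ext <;> dsimp only <;> grind
  have l3 : a * a * b' =
      ⟨w + z ^ 2 + z ^ 3, w + z ^ 2, z, w + 1 + z⟩ := by
    rw [l2, hb', QuaternionAlgebra.mk_mul_mk]
    ext <;> dsimp only <;> grind
  have l4 : a * a * b' * a' =
      ⟨w + z + z ^ 3, z, w + 1, z⟩ := by
    rw [l3, ha', QuaternionAlgebra.mk_mul_mk]
    ext <;> dsimp only <;> grind
  have l5 : a * a * b' * a' * b' =
      ⟨w + z + z ^ 2, w + 1 + z + z ^ 2, 1 + z, w + 1⟩ := by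
    rw [l4, hb', QuaternionAlgebra.mk_mul_mk]
    ext <;> dsimp only <;> grind
  have l6 : a * a * b' * a' * b' * b' =
      ⟨w ^ 2 + w + 1 + z ^ 3, w ^ 2 + w + 1, 0, w ^ 2 + w + z⟩ := by
    rw [l5, hb', QuaternionAlgebra.mk_mul_mk]
    ext <;> dsimp only <;> grind
  have l7 : a * a * b' * a' * b' * b' * a =
      ⟨w ^ 2, z, w ^ 2 + 1, 0⟩ := by
    rw [l6, ha, QuaternionAlgebra.mk_mul_mk]
    ext <;> dsimp only <;> grind
  have r2 : b' * b' =
      ⟨w ^ 2, w ^ 2, 0, w ^ 2⟩ := by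
    rw [hb', QuaternionAlgebra.mk_mul_mk]
    ext <;> dsimp only <;> grind
  have r3 : b' * b' * a =
      ⟨w ^ 2 + w + z ^ 2, 1 + z, w ^ 2 + w + 1, 1⟩ := by
    rw [r2, ha, QuaternionAlgebra.mk_mul_mk]
    ext <;> dsimp only <;> grind
  have r4 : b' * b' * a * b' =
      ⟨z + z ^ 2, w + 1 + z, w + 1, w + 1⟩ := by
    rw [r3, hb', QuaternionAlgebra.mk_mul_mk]
    ext <;> dsimp only <;> grind
  have r5 : b' * b' * a * b' * a' =
      ⟨1 + z + z ^ 2, w + 1, w, w + 1⟩ := by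
    rw [r4, ha', QuaternionAlgebra.mk_mul_mk]
    ext <;> dsimp only <;> grind
  have r6 : b' * b' * a * b' * a' * b =
      ⟨w ^ 2, z, w ^ 2 + 1, 0⟩ := by
    rw [r5, hb, QuaternionAlgebra.mk_mul_mk]
    ext <;> dsimp only <;> grind
  rw [l7, r6]

theorem relation_one :
    A2 * A1 * A2 * A1⁻¹ * A2 * A2 =
      A1 * A2⁻¹ * A2⁻¹ * A1⁻¹ * A2⁻¹ * A1⁻¹ := by
  apply Units.ext
  simp only [Units.val_mul]
  exact quaternion_relation_one z0_mul_w0 coe_A1 coe_A1_inv coe_A2 coe_A2_inv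

theorem relation_two :
    A1 * A1 * A2⁻¹ * A1⁻¹ * A2⁻¹ * A2⁻¹ * A1 =
      A2⁻¹ * A2⁻¹ * A1 * A2⁻¹ * A1⁻¹ * A2 := by
  apply Units.ext
  simp only [Units.val_mul]
  exact quaternion_relation_two z0_mul_w0 coe_A1 coe_A1_inv coe_A2 coe_A2_inv

/-! ### Upper bound: the abelianization is cyclic and killed by 15 -/

theorem toGR1_A1_mem : toGR1 A1 ∈ Gam :=
  toGR1_A1 ▸ Subgroup.subset_closure (Set.mem_insert _ _)

theorem toGR1_A2_mem : toGR1 A2 ∈ Gam :=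
  toGR1_A2 ▸ Subgroup.subset_closure (Set.mem_insert_of_mem _ rfl)

/-- The element `a₁` of `Γ`. -/
noncomputable def g1 : Gam := ⟨toGR1 A1, toGR1_A1_mem⟩

/-- The element `a₂` of `Γ`. -/
noncomputable def g2 : Gam := ⟨toGR1 A2, toGR1_A2_mem⟩

theorem closure_g1_g2 : Subgroup.closure {g1, g2} = ⊤ := by
  have h := Subgroup.closure_closure_coe_preimage (k := {c1 * b1⁻¹, c2 * b2⁻¹})
  have hs : ({g1, g2} : Set Gam) = Subtype.val ⁻¹' {c1 * b1⁻¹, c2 * b2⁻¹} := by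
    ext x
    simp [g1, g2, toGR1_A1, toGR1_A2, Subtype.ext_iff]
  rw [hs]
  exact h

theorem Gam_le_range : Gam ≤ toGR1.range := by
  refine (Subgroup.closure_le _).2 ?_
  rintro _ (rfl | rfl)
  · exact ⟨A1, toGR1_A1⟩
  · exact ⟨A2, toGR1_A2⟩

theorem eq_sq_of_relation {A : Type*} [CommGroup A] {x y : A}
    (h : x * x * y⁻¹ * x⁻¹ * y⁻¹ * y⁻¹ * x = y⁻¹ * y⁻¹ * x * y⁻¹ * x⁻¹ * y) : y = x ^ 2 := by
  have e1 : x * x * y⁻¹ * x⁻¹ * y⁻¹ * y⁻¹ * x = x ^ 2 * (y ^ 3)⁻¹ := by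
    apply Additive.ofMul.injective
    simp only [ofMul_mul, ofMul_inv, ofMul_pow]
    abel
  have e2 : y⁻¹ * y⁻¹ * x * y⁻¹ * x⁻¹ * y = y * (y ^ 3)⁻¹ := by
    apply Additive.ofMul.injective
    simp only [ofMul_mul, ofMul_inv, ofMul_pow]
    abel
  rw [e1, e2] at h
  exact (mul_right_cancel h).symm

theorem pow_eq_one_of_relation {A : Type*} [CommGroup A] {x y : A} (hy : y = x ^ 2)
    (h : y * x * y * x⁻¹ * y * y = x * y⁻¹ * y⁻¹ * x⁻¹ * y⁻¹ * x⁻¹) : x ^ 15 = 1 := by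
  subst hy
  have e1 : x ^ 2 * x * x ^ 2 * x⁻¹ * x ^ 2 * x ^ 2 = x ^ 8 := by group
  have e2 : x * (x ^ 2)⁻¹ * (x ^ 2)⁻¹ * x⁻¹ * (x ^ 2)⁻¹ * x⁻¹ = (x ^ 7)⁻¹ := by group
  rw [e1, e2, eq_inv_iff_mul_eq_one, ← pow_add] at h
  exact h

theorem abelianization_g2 : Abelianization.of g2 = Abelianization.of g1 ^ 2 := by
  have h : g1 * g1 * g2⁻¹ * g1⁻¹ * g2⁻¹ * g2⁻¹ * g1 = g2⁻¹ * g2⁻¹ * g1 * g2⁻¹ * g1⁻¹ * g2 :=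
    Subtype.ext (by
      have := congrArg toGR1 relation_two
      simp only [map_mul, map_inv] at this
      exact this)
  have h' := congrArg Abelianization.of h
  simp only [map_mul, map_inv] at h'
  exact eq_sq_of_relation h'

theorem abelianization_g1_pow : Abelianization.of g1 ^ 15 = 1 := by
  have h : g2 * g1 * g2 * g1⁻¹ * g2 * g2 = g1 * g2⁻¹ * g2⁻¹ * g1⁻¹ * g2⁻¹ * g1⁻¹ :=
    Subtype.ext (by
      have := congrArg toGR1 relation_one
      simp only [map_mul, map_inv] at this
      exact this)
  have h' := congrArg Abelianization.of h
  simp only [map_mul, map_inv] at h'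
  exact pow_eq_one_of_relation abelianization_g2 h'

theorem zpowers_abelianization_g1 : Subgroup.zpowers (Abelianization.of g1) = ⊤ := by
  have h := congrArg (Subgroup.map Abelianization.of) closure_g1_g2
  rw [MonoidHom.map_closure, Set.image_pair, ← MonoidHom.range_eq_map,
    MonoidHom.range_eq_top.2
      (show Function.Surjective Abelianization.of from QuotientGroup.mk_surjective)] at h
  rw [eq_top_iff, ← h, Subgroup.closure_le]
  rintro _ (rfl | rfl)
  · exact Subgroup.mem_zpowers _
  · rw [abelianization_g2]
    exact Subgroup.pow_mem _ (Subgroup.mem_zpowers _) 2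

/-! ### Lower bound: characters of orders 3 and 5 -/

/-- A character of `𝔒₀ˣ` that is trivial on units with vanishing `I`-coordinate factors through `Γᵃᵇ`. -/
theorem exists_abelianization_hom {M : Type*} [CommGroup M] (χ : O0ˣ →* M)
    (hχ : ∀ u : O0ˣ, (u : O0).imI = 0 → χ u = 1) :
    ∃ ψ : Abelianization Gam →* M, ψ (Abelianization.of g1) = χ A1 := by
  have hker : toGR1.rangeRestrict.ker ≤ χ.ker := fun u hu =>
    hχ u (imI_eq_zero_of_toGR1_eq_one (congrArg Subtype.val hu))
  have hsurj := Function.rightInverse_surjInv toGR1.rangeRestrict_surjective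
  let ψ := toGR1.rangeRestrict.liftOfRightInverse _ hsurj ⟨χ, hker⟩
  refine ⟨Abelianization.lift (ψ.comp (Subgroup.inclusion Gam_le_range)), ?_⟩
  refine (Abelianization.lift_apply_of _ _).trans ?_
  exact MonoidHom.liftOfRightInverse_comp_apply _ _ hsurj ⟨χ, hker⟩ A1

/-- The reduction of `𝔒₀` modulo a place where `1 + z³` vanishes: `z ↦ f z`, `I ↦ i`, `J ↦ 0`. -/
noncomputable def reduction {T : Type*} [CommRing T] (f : R0 →+* T) (i : T)
    (hi : i ^ 2 = i + f z0) (hz : 1 + f z0 ^ 3 = 0) : O0 →* T where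
  toFun q := f q.re + f q.imI * i
  map_one' := by simp
  map_mul' p q := by
    simp
    -- The product of the `I`-terms needs the equation for `i`; every product of two terms involving
    -- `J` carries the factor `J² = 1 + z³`, which vanishes.
    linear_combination (- f p.imI * f q.imI) * hi +
      (f p.imJ * f q.imJ + f p.imJ * f q.imK - f p.imK * f q.imK * f z0
        - i * (f p.imJ * f q.imK - f p.imK * f q.imJ)) * hz

/-- With `n + 1` the size of the residue field of `R0`, the `n`-th power of the reduction kills
scalars, hence is a character of `Γ`; its value at `a₁` has order exactly `p`. -/
theorem orderOf_dvd_of_reduction {T : Type*} [CommRing T] (f : R0 →+* T) (i : T)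
    (hi : i ^ 2 = i + f z0) (hz : 1 + f z0 ^ 3 = 0) (n p : ℕ) [Fact p.Prime]
    (hn : ∀ r, f r ^ (n + 1) = f r)
    (h1 : (1 + f z0 ^ 2 + f z0 * i) ^ n ≠ 1) (hp : ((1 + f z0 ^ 2 + f z0 * i) ^ n) ^ p = 1) :
    p ∣ orderOf (Abelianization.of g1) := by
  obtain ⟨ψ, hψ⟩ := exists_abelianization_hom
    ((powMonoidHom n).comp (Units.map (reduction f i hi hz))) fun u hu => by
      have h : ((Units.map (reduction f i hi hz) u : Tˣ) : T) = f (u : O0).re := by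
        simp [reduction, hu]
      have h' := hn (u : O0).re
      -- The reduction of `u` is a unit, so one factor cancels from `x ^ (n + 1) = x`.
      rw [← h, ← Units.val_pow_eq_pow_val, Units.val_inj, pow_succ, mul_eq_right] at h'
      exact h'
  have hA : ((ψ (Abelianization.of g1) : Tˣ) : T) = (1 + f z0 ^ 2 + f z0 * i) ^ n := by
    rw [hψ]
    simp [reduction, A1]
  rw [← orderOf_eq_prime (x := ψ (Abelianization.of g1)) (p := p)]
  · exact orderOf_map_dvd ψ _
  · exact Units.ext (by simpa [hA] using hp)
  · exact fun h => h1 (by rw [← hA, h, Units.val_one])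

/-- At `z = 1` the lift `A1` reduces to `i`, a primitive cube root of unity. -/
theorem three_dvd_orderOf_of_isAlgClosed (T : Type*) [Field T] [IsAlgClosed T] [CharP T 2]
    [Algebra (ZMod 2) T] : 3 ∣ orderOf (Abelianization.of g1) := by
  obtain ⟨i, hi⟩ : ∃ i : T, i ^ 2 + i + 1 = 0 := by
    obtain ⟨i, hi⟩ := IsAlgClosed.exists_root (X ^ 2 + X + 1 : T[X]) (by
      have : (X ^ 2 + X + 1 : T[X]).degree = 2 := by compute_degree!
      simp [this])
    exact ⟨i, by simpa using hi⟩
  let f := evalR0 (1 : T) isUnit_one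
  have hf : f z0 = 1 := evalR0_z0 _ _
  have hfrob : (frobenius T 2).comp f = f := ringHom_R0_ext (by simp [hf])
  refine orderOf_dvd_of_reduction f i ?_ ?_ 1 3 (fun r => RingHom.congr_fun hfrob r) ?_ ?_
  all_goals rw [hf]
  all_goals grind

/-- At `z = i² + i`, a primitive cube root of unity, `A1` reduces to `z (1 + i) = z i⁴`. Its cube is
`i¹²`, of order 5 since `i` has order 15. -/
theorem five_dvd_orderOf_of_isAlgClosed (T : Type*) [Field T] [IsAlgClosed T] [CharP T 2]
    [Algebra (ZMod 2) T] : 5 ∣ orderOf (Abelianization.of g1) := by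
  have : Fact (Nat.Prime 5) := ⟨by norm_num⟩
  obtain ⟨i, hi⟩ : ∃ i : T, i ^ 4 + i + 1 = 0 := by
    obtain ⟨i, hi⟩ := IsAlgClosed.exists_root (X ^ 4 + X + 1 : T[X]) (by
      have : (X ^ 4 + X + 1 : T[X]).degree = 4 := by compute_degree!
      simp [this])
    exact ⟨i, by simpa using hi⟩
  let f := evalR0 (i ^ 2 + i) (IsUnit.of_mul_eq_one (i ^ 2 + i + 1) (by grind))
  have hf : f z0 = i ^ 2 + i := evalR0_z0 _ _
  -- The image of `f` lies in 𝔽₄, the fixed field of the squared Frobenius.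
  have hfrob : ((frobenius T 2).comp (frobenius T 2)).comp f = f := ringHom_R0_ext (by
    simp only [RingHom.comp_apply, frobenius_def, hf]
    grind)
  refine orderOf_dvd_of_reduction f i ?_ ?_ 3 5 (fun r => ?_) ?_ ?_
  · rw [hf]; grind
  · rw [hf]; grind
  · rw [show 3 + 1 = 2 * 2 from rfl, pow_mul]
    exact RingHom.congr_fun hfrob r
  · rw [hf]; grind
  · rw [hf]; grind

instance charP_algebraicClosure : CharP (AlgebraicClosure (ZMod 2)) 2 :=
  charP_of_injective_algebraMap (algebraMap (ZMod 2) _).injective 2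

theorem orderOf_abelianization_g1 : orderOf (Abelianization.of g1) = 15 :=
  Nat.dvd_antisymm (orderOf_dvd_of_pow_eq_one abelianization_g1_pow)
    (Nat.Coprime.mul_dvd_of_dvd_of_dvd (by norm_num)
      (three_dvd_orderOf_of_isAlgClosed (AlgebraicClosure (ZMod 2)))
      (five_dvd_orderOf_of_isAlgClosed (AlgebraicClosure (ZMod 2))))

end QuatLattice

theorem mainTheorem9 :
    Nonempty (Abelianization QuatLattice.Gam ≃* Multiplicative (ZMod 15)) := by
  have hcard : Nat.card (Abelianization QuatLattice.Gam) = 15 := by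
    rw [← QuatLattice.orderOf_abelianization_g1, ← Nat.card_zpowers,
      QuatLattice.zpowers_abelianization_g1, Subgroup.card_top]
  have hcyc : IsCyclic (Abelianization QuatLattice.Gam) :=
    ⟨_, (Subgroup.eq_top_iff' _).1 QuatLattice.zpowers_abelianization_g1⟩
  exact ⟨mulEquivOfCyclicCardEq (by simp [hcard])⟩
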